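/- **Setting.** An *occupied surface* $(\Sigma,V)$ is a compact oriented surface $\Sigma$ (possibly disconnected), every component of which has nonempty boundary, with a finite set $V=V_+\sqcup V_-\subset\partial\Sigma$ of signed vertices such that every boundary component contains vertices and vertices alternate in sign along it; on each boundary edge a point is fixed at which sutures end. A *square* (resp. *vacuum*) is a disc with four (resp. two) vertices. A *set of sutures* $\Gamma$ on $(\Sigma,V)$ is a properly embedded $1$-submanifold with exactly one endpoint (the fixed one) on each boundary edge, with $\Sigma\setminus\Gamma=R_+\sqcup R_-$, $V_\pm\subset R_\pm$, the sign switching across $\Gamma$; its Euler class is $e(\Gamma)=\chi(R_+)-\chi(R_-)$. On a square, $\Gamma_+$ (resp. $\Gamma_-$) denotes the sutures consisting of two arcs which cut off the two positive (resp. negative) corners. A *morphism* $\phi:(\Sigma,V)\to(\Sigma',V')$ is a continuous map which embeds the interior, preserving orientation, may fold or glue boundary edges (images of edges which meet other than at endpoints coincide, and an edge meeting $\partial\Sigma'$ is sent onto a boundary edge), and respects the signs of vertices and the endpoints of sutures; a *decorated morphism* $(\phi,\Gamma_c)$ is a morphism with a set of sutures $\Gamma_c$ on the complement of its image. Decorated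 morphisms compose by $(\phi',\Gamma_c')\circ(\phi,\Gamma_c)=(\phi'\circ\phi,\ \phi'(\Gamma_c)\cup\Gamma'_c)$ and send sutures $\Gamma$ to $\Gamma\cup\Gamma_c:=\phi(\Gamma)\cup\Gamma_c$. A *decorated isotopy* is a continuous family of decorated morphisms, except that at some times vacuum components of the complement (each with a single arc of sutures) may be created or removed. A *quadrangulation* of $(\Sigma,V)$ decomposes $\Sigma$, apart from its vacuum components, into squares $(\Sigma_i^\square,V_i^\square)$ glued along edges, without creating interior vertices. Sutures are *basic* for a quadrangulation if they contain no contractible closed curve and meet each edge of each square once. A *twisted SQFT* $(\mathcal D,c)$ assigns to each occupied surface a $\mathbb Z$-graded $\mathbb Z[H_1(\Sigma)]$-module $\mathcal V(\Sigma,V)$ (with finitely many nonzero summands); to each decorated-isotopy class of decorated morphisms a graded module homomorphism $\mathcal D_{\phi,\Gamma_c}:\mathcal V(\Sigma,V)\to\mathcal V(\Sigma',V')$ of some degree over $\phi_*:\mathbb Z[H_1(\Sigma)]\to\mathbb Z[H_1(\Sigma')]$, defined up to a unit of $\mathbb Z[H_1(\Sigma')]$ in each graded summand; and to each isotopy class of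 sutures $\Gamma$ on $(\Sigma,V)$ a $\mathbb Z[H_1(\Sigma)]^\times$-orbit $c(\Gamma)\subset\mathcal V(\Sigma,V)$; such that 1. $\mathcal D$ respects identities and compositions up to units; 2. for each quadrangulation there is an isomorphism $\mathcal V(\Sigma,V)\cong\mathbb Z[H_1(\Sigma)]\otimes_{\mathbb Z}\bigotimes_i\mathcal V(\Sigma_i^\square,V_i^\square)$ (tensor products over $\mathbb Z$) under which $c(\Gamma)=\mathbb Z[H_1(\Sigma)]^\times\otimes\bigotimes_i c(\Gamma_i)$ for all basic $\Gamma$ with restrictions $\Gamma_i$ to the squares; 3. $\mathcal D_{\phi,\Gamma_c}(c(\Gamma))\subseteq c(\Gamma\cup\Gamma_c)$; 4. on a square, $c(\Gamma_-)=\{\pm\mathbf 0\}$ and $c(\Gamma_+)=\{\pm\mathbf 1\}$, where $\mathbf 0,\mathbf 1$ is a free basis of $\mathcal V(\Sigma^\square,V^\square)$ over $\mathbb Z$; 5. $\mathbf 0,\mathbf 1$ have degrees $-1,1$, the isomorphisms in (2) are compatible with the gradings (coefficients having degree $0$), and $c(\Gamma)$ lies in degree $e(\Gamma)$. An (untwisted)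 *SQFT* $(\mathcal D,c)$ consists of a functor $\mathcal D$ from decorated occupied surfaces to $\mathbb Z_2$-vector spaces, with spaces $\mathcal V(\Sigma,V)$, and a single element $c(\Gamma)\in\mathcal V(\Sigma,V)$ for each isotopy class of sutures, such that: quadrangulations give isomorphisms $\mathcal V(\Sigma,V)\cong\bigotimes_i\mathcal V(\Sigma_i^\square,V_i^\square)$ under which $c(\Gamma)=\bigotimes_i c(\Gamma_i)$ for basic $\Gamma$; $\mathcal D_{\phi,\Gamma_c}(c(\Gamma))=c(\Gamma\cup\Gamma_c)$; on a square, $c(\Gamma_-)=\mathbf 0$ and $c(\Gamma_+)=\mathbf 1$ form a basis; and, for the grading on all $\mathcal V(\Sigma,V)$ induced from degrees $-1,1$ of $\mathbf 0,\mathbf 1$ by these isomorphisms, $c(\Gamma)$ has degree $e(\Gamma)$. **Reduction.** Let $r_\Sigma:\mathbb Z[H_1(\Sigma)]\to\mathbb Z_2$ be the sum of coefficients mod $2$. For a twisted SQFT $(\mathcal D,c)$ let $\mathcal V_r(\Sigma,V)=\mathbb Z_2\otimes_{\mathbb Z[H_1(\Sigma)]}\mathcal V(\Sigma,V)$ (coefficients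 changed along $r_\Sigma$), with reduction map $R_{\Sigma,V}:\mathcal V(\Sigma,V)\to\mathcal V_r(\Sigma,V)$, $x\mapsto 1\otimes x$, graded by the $\mathbb Z_2$-spans of the images of the graded summands. **Proposition.** Let $(\mathcal D,c)$ be a twisted SQFT. (a) Each quadrangulation of $(\Sigma,V)$ gives bases $|\mathbf e_1\cdots\mathbf e_n\rangle$ ($\mathbf e_i\in\{\mathbf 0,\mathbf 1\}$) of $\mathcal V(\Sigma,V)$ over $\mathbb Z[H_1(\Sigma)]$, and $R_{\Sigma,V}$ carries each such basis to a $\mathbb Z_2$-basis of $\mathcal V_r(\Sigma,V)$. So $\mathcal V_r(\Sigma,V)$ is the free $\mathbb Z_2$-module on the same basis, and $R_{\Sigma,V}$ is the identity on basis elements. (b) There are unique $\mathbb Z_2$-linear maps $\mathcal D^r_{\phi,\Gamma_c}:\mathcal V_r(\Sigma,V)\to\mathcal V_r(\Sigma',V')$ such that $\mathcal D^r_{\phi,\Gamma_c}\circ R_{\Sigma,V}=R_{\Sigma',V'}\circ f$ for all representatives $f$ of $\mathcal D_{\phi,\Gamma_c}$, and $\mathcal D^r_{\phi,\Gamma_c}$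 is graded of degree $n$ whenever some representative is; and there are unique elements $c_r(\Gamma)$ with $R_{\Sigma,V}(c(\Gamma))=\{c_r(\Gamma)\}$. (c) The assignments $(\Sigma,V)\rightsquigarrow\mathcal V_r(\Sigma,V)$, $(\phi,\Gamma_c)\rightsquigarrow\mathcal D^r_{\phi,\Gamma_c}$ and $\Gamma\rightsquigarrow c_r(\Gamma)$ form an SQFT, and its grading by Euler class is the reduced grading. -/

import Mathlib

open scoped Manifold TensorProduct
open CategoryTheory Set Filter Topology

noncomputable section

namespace SQFT

/-! ### Occupied surfaces -/

/-- `h` preserves orientation at `z`: the image of each small positively oriented circle around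
`z` winds once positively around `h z` (`θ` is a continuous logarithm along the image loop). -/
def PreservesOrientationAt (h : ℂ → ℂ) (z : ℂ) : Prop :=
  ∀ᶠ r : ℝ in 𝓝[>] 0, ∃ θ : ℝ → ℂ, Continuous θ ∧
    (∀ t, Complex.exp (θ t) = h (circleMap z r t) - h z) ∧
    θ (2 * Real.pi) - θ 0 = 2 * Real.pi * Complex.I

/-- The edges cut out on a boundary `B` by a set `V` of vertices: the connected components of
`B \ V`. These are the open edges, without their endpoints. -/
def edgesOf {X : Type} [TopologicalSpace X] (B V : Set X) : Set (Set X) :=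
  {e | ∃ x ∈ B \ V, e = connectedComponentIn (B \ V) x}

/-- An occupied surface `(Σ, V)`: a compact oriented surface (possibly disconnected or empty) with
signed vertices on the boundary. The last component `marks` is the set `F` of boundary points of
the associated sutured background surface, one on each boundary edge; it records where sutures
end. -/
structure OccupiedSurface where
  carrier : Type
  [top : TopologicalSpace carrier]
  [t2 : T2Space carrier]
  [compact : CompactSpace carrier]
  [charted : ChartedSpace (EuclideanHalfSpace 2) carrier]
  /-- an oriented atlas of the interior -/
  orient : Set (OpenPartialHomeomorph carrier ℂ)
  orient_cover : ∀ x ∈ (𝓡∂ 2).interior carrier, ∃ e ∈ orient, x ∈ e.source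
  orient_compat : ∀ e ∈ orient, ∀ e' ∈ orient, ∀ x ∈ e.source ∩ e'.source,
    PreservesOrientationAt (fun z => e' (e.symm z)) (e x)
  /-- positive vertices -/
  pos : Set carrier
  /-- negative vertices -/
  neg : Set carrier
  verts_finite : (pos ∪ neg).Finite
  verts_boundary : pos ∪ neg ⊆ (𝓡∂ 2).boundary carrier
  pos_neg_disjoint : Disjoint pos neg
  /-- each component of the surface has nonempty boundary -/
  component_boundary : ∀ x : carrier,
    (connectedComponent x ∩ (𝓡∂ 2).boundary carrier).Nonempty
  /-- each component of the boundary contains vertices -/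
  boundary_verts : ∀ x ∈ (𝓡∂ 2).boundary carrier,
    (connectedComponentIn ((𝓡∂ 2).boundary carrier) x ∩ (pos ∪ neg)).Nonempty
  /-- vertices alternate in sign: each boundary edge joins a positive and a negative vertex -/
  alternate : ∀ e ∈ edgesOf ((𝓡∂ 2).boundary carrier) (pos ∪ neg),
    (∃! v, v ∈ closure e ∩ pos) ∧ (∃! v, v ∈ closure e ∩ neg)
  marks : Set carrier
  marks_boundary : marks ⊆ (𝓡∂ 2).boundary carrier \ (pos ∪ neg)
  marks_edge : ∀ e ∈ edgesOf ((𝓡∂ 2).boundary carrier) (pos ∪ neg), ∃! x, x ∈ e ∩ marks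

attribute [instance] OccupiedSurface.top OccupiedSurface.t2 OccupiedSurface.compact
  OccupiedSurface.charted

instance : CoeSort OccupiedSurface Type := ⟨OccupiedSurface.carrier⟩

namespace OccupiedSurface

/-- the boundary of the surface -/
def bdry (S : OccupiedSurface) : Set S := (𝓡∂ 2).boundary S
/-- the interior of the surface -/
def inter (S : OccupiedSurface) : Set S := (𝓡∂ 2).interior S
/-- all vertices -/
def verts (S : OccupiedSurface) : Set S := S.pos ∪ S.neg
/-- the open boundary edges -/
def edges (S : OccupiedSurface) : Set (Set S) := edgesOf S.bdry S.verts

/-- A square is a disc with four vertices. -/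
def IsSquare (S : OccupiedSurface) : Prop :=
  Nonempty (S ≃ₜ Metric.closedBall (0 : ℂ) 1) ∧ S.verts.ncard = 4

/-- The union of the components of `S` that are vacua, i.e. discs with two vertices. -/
def vacuumPart (S : OccupiedSurface) : Set S :=
  {x | Nonempty (connectedComponent x ≃ₜ Metric.closedBall (0 : ℂ) 1) ∧
    (connectedComponent x ∩ S.verts).ncard = 2}

end OccupiedSurface

/-! ### Morphisms -/

/-- A morphism of occupied surfaces: a continuous map which embeds the interior, preserving
orientation; boundary edges may be glued or folded together, but the images of two edges that meet
other than at endpoints coincide; an edge that meets the boundary of the target is sent onto a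
boundary edge; signs of vertices are respected, and so are the endpoints of sutures. -/
structure Morphism (S S' : OccupiedSurface) where
  map : C(S, S')
  embed : IsEmbedding (S.inter.domRestrict map)
  oriented : ∀ e ∈ S.orient, ∀ e' ∈ S'.orient, ∀ x ∈ e.source, map x ∈ e'.source →
    PreservesOrientationAt (fun z => e' (map (e.symm z))) (e x)
  edge_inj : ∀ e ∈ S.edges, InjOn map e
  edge_coincide : ∀ e ∈ S.edges, ∀ e' ∈ S.edges, (map '' e ∩ map '' e').Nonempty →
    map '' e = map '' e'
  edge_boundary : ∀ e ∈ S.edges, (map '' e ∩ S'.bdry).Nonempty → map '' e ∈ S'.edges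
  vert_edge : Disjoint (map '' S.verts) (map '' (S.bdry \ S.verts))
  pos_neg : Disjoint (map '' S.pos) (map '' S.neg)
  pos_boundary : map '' S.pos ∩ S'.bdry ⊆ S'.pos
  neg_boundary : map '' S.neg ∩ S'.bdry ⊆ S'.neg
  marks_glue : ∀ x ∈ S.marks, ∀ y ∈ S.bdry, map x = map y → y ∈ S.marks
  marks_boundary : map '' S.marks ∩ S'.bdry ⊆ S'.marks

namespace Morphism

variable {S S' : OccupiedSurface} (φ : Morphism S S')

/-- The complement of the image. As a subset of the target, the complementary occupied surface may
touch itself at vertices; sutures stay away from vertices. -/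
def compl : Set S' := closure (range φ.map)ᶜ
/-- vertices (of the target or images of vertices) -/
def verts : Set S' := S'.verts ∪ φ.map '' S.verts

end Morphism

/-! ### Sutures -/

/-- `Γ` is a set of sutures on the region `C` of a surface, where the boundary points of `C` are
its points on `B`, sutures end at the points of `F` in `C`, and `P`, `N` contain the positive and
negative vertices. `Γ` is a properly embedded 1-submanifold of `C`: in suitable half-plane charts
`{(x₀, x₁) | 0 ≤ x₀}` of `C` it is the axis `x₁ = 0`. It cuts `C` into positive and negative regions
`Rp`, `Rn`, and crossing `Γ` switches the sign. (The orientation of `Γ` is the one as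
the boundary of the oriented region `Rp`.) -/
structure IsSutured {X : Type} [TopologicalSpace X] (C B F P N Γ Rp Rn : Set X) : Prop where
  closed : IsClosed Γ
  sub : Γ ⊆ C
  submanifold : ∀ x : C, (x : X) ∈ Γ → ∃ e : OpenPartialHomeomorph C (EuclideanHalfSpace 2),
    x ∈ e.source ∧ ∀ y ∈ e.source, ((y : X) ∈ Γ ↔ (e y).1 1 = 0)
  endpoints : Γ ∩ B = F ∩ C
  cover : Rp ∪ Rn = C \ Γ
  disj : Disjoint Rp Rn
  openPos : IsOpen ((↑) ⁻¹' Rp : Set C)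
  openNeg : IsOpen ((↑) ⁻¹' Rn : Set C)
  switch : Γ ⊆ closure Rp ∩ closure Rn
  posVerts : P ∩ C ⊆ Rp
  negVerts : N ∩ C ⊆ Rn

/-- A set of sutures on an occupied surface, with its positive and negative regions (which are
determined by the curve). -/
structure Sutures (S : OccupiedSurface) where
  curve : Set S
  regionPos : Set S
  regionNeg : Set S
  sutured : IsSutured univ S.bdry S.marks S.pos S.neg curve regionPos regionNeg

/-- A decorated morphism: a morphism with a set of sutures on the complement of its image. -/
structure DecoratedMorphism (S S' : OccupiedSurface) extends Morphism S S' where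
  curve : Set S'
  regionPos : Set S'
  regionNeg : Set S'
  sutured : IsSutured toMorphism.compl (S'.bdry ∪ map '' S.bdry) (S'.marks ∪ map '' S.marks)
    (S'.pos ∪ map '' S.pos) (S'.neg ∪ map '' S.neg) curve regionPos regionNeg

/-- singular homology with integer coefficients -/
abbrev Homology (n : ℕ) (X : Type) [TopologicalSpace X] : ModuleCat.{0} ℤ :=
  ((AlgebraicTopology.singularHomologyFunctor (ModuleCat.{0} ℤ) n).obj (ModuleCat.of ℤ ℤ)).obj
    (TopCat.of X)

/-- Euler characteristic of a space without homology in degrees above two -/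
def eulerChar (X : Type) [TopologicalSpace X] : ℤ :=
  ∑ i ∈ Finset.range 3, (-1) ^ i * (Module.finrank ℤ (Homology i X) : ℤ)

/-- `Γ t` moves continuously as an embedded curve. -/
def IsMotion {X : Type} [TopologicalSpace X] (Γ : unitInterval → Set X) : Prop :=
  ∃ G : unitInterval × Γ 0 → X, Continuous G ∧
    ∀ t, Function.Injective (fun y => G (t, y)) ∧ range (fun y => G (t, y)) = Γ t

namespace Sutures

variable {S : OccupiedSurface}

/-- the Euler class `e(Γ) = χ(R₊) - χ(R₋)` -/
def eulerClass (Γ : Sutures S) : ℤ := eulerChar Γ.regionPos - eulerChar Γ.regionNeg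

/-- isotopy of sutures (relative to endpoints, as sutures always end at the marked points) -/
def Isotopic (Γ Γ' : Sutures S) : Prop :=
  ∃ fam : unitInterval → Sutures S, fam 0 = Γ ∧ fam 1 = Γ' ∧ IsMotion fun t => (fam t).curve

/-- no contractible closed curve among the sutures -/
def Nontrivial (Γ : Sutures S) : Prop :=
  ¬ ∃ γ : C(Circle, S), Function.Injective γ ∧ range γ ⊆ Γ.curve ∧ γ.Nullhomotopic

/-- On a square: the basic sutures `Γ₊`, two arcs cutting off the two positive corners. -/
def IsPlus (Γ : Sutures S) : Prop := S.IsSquare ∧ Γ.Nontrivial ∧ IsConnected Γ.regionNeg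

/-- On a square: the basic sutures `Γ₋`, two arcs cutting off the two negative corners. -/
def IsMinus (Γ : Sutures S) : Prop := S.IsSquare ∧ Γ.Nontrivial ∧ IsConnected Γ.regionPos

end Sutures

namespace DecoratedMorphism

variable {S S' S'' : OccupiedSurface}

/-- `Γ'` is the image `Γ ∪ Γ_c` of the sutures `Γ` under the decorated morphism. -/
def Sends (m : DecoratedMorphism S S') (Γ : Sutures S) (Γ' : Sutures S') : Prop :=
  Γ'.curve = m.map '' Γ.curve ∪ m.curve

/-- `m` is the identity morphism (the complement of its image is empty). -/
def IsId (m : DecoratedMorphism S S) : Prop := ∀ x, m.map x = x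

/-- `m''` is the composition of `m` and then `m'`. -/
def IsComp (m : DecoratedMorphism S S') (m' : DecoratedMorphism S' S'')
    (m'' : DecoratedMorphism S S'') : Prop :=
  (∀ x, m''.map x = m'.map (m.map x)) ∧ m''.curve = m'.map '' m.curve ∪ m'.curve

/-- `B` is a vacuum component of the complement of the image: a disc with two vertices. -/
def IsComplementaryVacuum (m : DecoratedMorphism S S') (B : Set S') : Prop :=
  (∃ x ∈ m.compl \ m.verts, B = closure (connectedComponentIn (m.compl \ m.verts) x)) ∧
    Nonempty (B ≃ₜ Metric.closedBall (0 : ℂ) 1) ∧ (B ∩ m.verts).ncard = 2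

/-- `fam` is a continuous family of decorated morphisms. -/
def IsContinuousFamily (fam : unitInterval → DecoratedMorphism S S') : Prop :=
  Continuous (fun p : unitInterval × S => (fam p.1).map p.2) ∧ IsMotion fun t => (fam t).curve

/-- `fam` is a family of decorated morphisms which is continuous apart from the creation of a
vacuum `B t` at `t = 0`: for `t > 0` it is a vacuum component of the complement, containing a single
arc of sutures, and it collapses onto the image of a boundary edge as `t → 0`. -/
def IsVacuumCreation (fam : unitInterval → DecoratedMorphism S S') : Prop :=
  Continuous (fun p : unitInterval × S => (fam p.1).map p.2) ∧
  ∃ B : unitInterval → Set S', B 0 = ∅ ∧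
    (∀ t, 0 < t → (fam t).IsComplementaryVacuum (B t) ∧ IsConnected ((fam t).curve ∩ B t)) ∧
    (∃ e ∈ S.edges, ∀ U : Set S', IsOpen U → (fam 0).map '' closure e ⊆ U →
      ∀ᶠ t in 𝓝[>] 0, B t ⊆ U) ∧
    IsMotion fun t => (fam t).curve \ B t

/-- Decorated isotopy: the equivalence relation generated by continuous families and families in
which a vacuum is created (or, in reverse time, removed). -/
def DecoratedIsotopic : DecoratedMorphism S S' → DecoratedMorphism S S' → Prop :=
  Relation.EqvGen fun m m' => ∃ fam : unitInterval → DecoratedMorphism S S',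
    fam 0 = m ∧ fam 1 = m' ∧ (IsContinuousFamily fam ∨ IsVacuumCreation fam)

end DecoratedMorphism

/-! ### Quadrangulations -/

/-- A quadrangulation: squares which are glued along boundary edges into the surface, no vertex
becoming interior, and which cover everything but the vacuum components (these carry the null
quadrangulation). -/
structure Quadrangulation (S : OccupiedSurface) where
  ι : Type
  [fintype : Fintype ι]
  sq : ι → OccupiedSurface
  isSquare : ∀ i, (sq i).IsSquare
  incl : ∀ i, Morphism (sq i) S
  verts : ∀ i, (incl i).map '' (sq i).verts ⊆ S.verts
  disj : ∀ i j, i ≠ j → Disjoint ((incl i).map '' (sq i).inter) (range (incl j).map)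
  edge_coincide : ∀ i j, ∀ e ∈ (sq i).edges, ∀ e' ∈ (sq j).edges,
    ((incl i).map '' e ∩ (incl j).map '' e').Nonempty → (incl i).map '' e = (incl j).map '' e'
  marks_glue : ∀ i j, ∀ x ∈ (sq i).marks, ∀ y ∈ (sq j).bdry,
    (incl i).map x = (incl j).map y → y ∈ (sq j).marks
  cover : ⋃ i, range (incl i).map = S.vacuumPartᶜ

attribute [instance] Quadrangulation.fintype

namespace Quadrangulation

variable {S : OccupiedSurface} (Q : Quadrangulation S)

/-- Basic sutures: nontrivial, and meeting each edge of each square in a single point. -/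
def IsBasic (Γ : Sutures S) : Prop :=
  Γ.Nontrivial ∧ ∀ i, ∀ e ∈ (Q.sq i).edges, ∃! x, x ∈ (Q.incl i).map '' e ∩ Γ.curve

/-- `Γ` restricts to the sutures `Γs i` on the squares. -/
def Restricts (Γ : Sutures S) (Γs : ∀ i, Sutures (Q.sq i)) : Prop :=
  ∀ i, (Γs i).curve = (Q.incl i).map ⁻¹' Γ.curve

end Quadrangulation

/-! ### Graded modules and group rings -/

/-- first homology of an occupied surface -/
abbrev H1 (S : OccupiedSurface) : Type := Homology 1 S

/-- the coefficient ring `ℤ[H₁(Σ)]` -/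
abbrev Coeff (S : OccupiedSurface) : Type := AddMonoidAlgebra ℤ (H1 S)

/-- the ring homomorphism `φ_* : ℤ[H₁(Σ)] → ℤ[H₁(Σ')]` -/
def Morphism.push {S S' : OccupiedSurface} (φ : Morphism S S') : Coeff S →+* Coeff S' :=
  AddMonoidAlgebra.mapDomainRingHom ℤ
    ((((AlgebraicTopology.singularHomologyFunctor (ModuleCat.{0} ℤ) 1).obj
      (ModuleCat.of ℤ ℤ)).map (TopCat.ofHom φ.map)).hom.toAddMonoidHom : H1 S →+ H1 S')

/-- The submodules `gr e` form a grading of the module, with finitely many nonzero summands. -/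
def IsGrading {R M : Type*} [Ring R] [AddCommGroup M] [Module R M] (gr : ℤ → Submodule R M) :
    Prop :=
  DirectSum.IsInternal gr ∧ {e | gr e ≠ ⊥}.Finite

/-- `f` is a graded module homomorphism of degree `n` over the ring homomorphism `σ`. -/
def IsGradedHom {R R' M M' : Type*} [Ring R] [Ring R'] [AddCommGroup M] [AddCommGroup M']
    [Module R M] [Module R' M'] (σ : R →+* R') (gr : ℤ → Submodule R M)
    (gr' : ℤ → Submodule R' M') (f : M →+ M') (n : ℤ) : Prop :=
  (∀ r x, f (r • x) = σ r • f x) ∧ ∀ e, ∀ x ∈ gr e, f x ∈ gr' (e + n)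

/-- `g` is `f` multiplied by a unit of `R'` on each graded summand. -/
def EqUpToUnits {R R' M M' : Type*} [Ring R] [Ring R'] [AddCommGroup M] [AddCommGroup M']
    [Module R M] [Module R' M'] (gr : ℤ → Submodule R M) (f g : M →+ M') : Prop :=
  ∃ z : ℤ → R'ˣ, ∀ e, ∀ x ∈ gr e, g x = (z e : R') • f x

/-! ### Sutured quadrangulated field theory (mod 2) -/

/-- `(D, c)` is a sutured quadrangulated field theory, `D` being a functor on decorated
occupied surfaces with values `V S` on objects, and `gr` its grading by Euler class. -/
structure IsSQFT (V : OccupiedSurface → Type*) [∀ S, AddCommGroup (V S)]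
    [∀ S, Module (ZMod 2) (V S)] (gr : ∀ S, ℤ → Submodule (ZMod 2) (V S))
    (D : ∀ S S', DecoratedMorphism S S' → (V S →ₗ[ZMod 2] V S'))
    (c : ∀ S, Sutures S → V S) : Prop where
  functor_id : ∀ S (m : DecoratedMorphism S S), m.IsId → D S S m = LinearMap.id
  functor_comp : ∀ S S' S'' (m : DecoratedMorphism S S') (m' : DecoratedMorphism S' S'')
    (m'' : DecoratedMorphism S S''), m.IsComp m' m'' → D S S'' m'' = D S' S'' m' ∘ₗ D S S' m
  isotopy : ∀ S (Γ Γ' : Sutures S), Γ.Isotopic Γ' → c S Γ = c S Γ'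
  grading : ∀ S, IsGrading (gr S)
  /-- tensor decompositions, which are compatible with basic sutures and with gradings -/
  tensor : ∀ S (Q : Quadrangulation S),
    ∃ Φ : V S ≃ₗ[ZMod 2] PiTensorProduct (ZMod 2) (fun i => V (Q.sq i)),
      (∀ Γ Γs, Q.IsBasic Γ → Q.Restricts Γ Γs →
        Φ (c S Γ) = PiTensorProduct.tprod (ZMod 2) (fun i => c (Q.sq i) (Γs i))) ∧
      (∀ (d : Q.ι → ℤ) (x : ∀ i, V (Q.sq i)), (∀ i, x i ∈ gr (Q.sq i) (d i)) →
        Φ.symm (PiTensorProduct.tprod (ZMod 2) x) ∈ gr S (∑ i, d i))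
  respects : ∀ S S' (m : DecoratedMorphism S S') (Γ : Sutures S) (Γ' : Sutures S'),
    m.Sends Γ Γ' → D S S' m (c S Γ) = c S' Γ'
  /-- basic sutures give a basis `𝟎, 𝟏` for a square, of degrees `-1, 1` -/
  square : ∀ S, S.IsSquare → ∃ b : Module.Basis Bool (ZMod 2) (V S),
    (∀ Γ : Sutures S, Γ.IsMinus → c S Γ = b false) ∧
    (∀ Γ : Sutures S, Γ.IsPlus → c S Γ = b true) ∧
    b false ∈ gr S (-1) ∧ b true ∈ gr S 1
  euler : ∀ S (Γ : Sutures S), c S Γ ∈ gr S Γ.eulerClass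

/-! ### Twisted sutured quadrangulated field theory -/

/-- The data `(D, c)` of a twisted SQFT. `D m` is the class of graded module homomorphisms, up
to units in each graded summand, and `c Γ` is an orbit of the units of the coefficient ring. -/
structure TwistedData where
  V : OccupiedSurface → Type*
  [group : ∀ S, AddCommGroup (V S)]
  [module : ∀ S, Module (Coeff S) (V S)]
  gr : ∀ S, ℤ → Submodule (Coeff S) (V S)
  D : ∀ S S', DecoratedMorphism S S' → Set (V S →+ V S')
  c : ∀ S, Sutures S → Set (V S)

attribute [instance] TwistedData.group TwistedData.module

namespace TwistedData

variable (T : TwistedData)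

/-- The isomorphism `Φ` is a tensor decomposition for the quadrangulation `Q`, compatible with
basic sutures and with gradings. -/
def IsTensorDecomposition {S : OccupiedSurface} (Q : Quadrangulation S)
    (Φ : T.V S ≃ₗ[Coeff S] Coeff S ⊗[ℤ] PiTensorProduct ℤ (fun i => T.V (Q.sq i))) : Prop :=
  (∀ Γ Γs, Q.IsBasic Γ → Q.Restricts Γ Γs →
    Φ '' T.c S Γ = {y | ∃ (u : (Coeff S)ˣ) (x : ∀ i, T.V (Q.sq i)),
      (∀ i, x i ∈ T.c (Q.sq i) (Γs i)) ∧ y = (u : Coeff S) ⊗ₜ PiTensorProduct.tprod ℤ x}) ∧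
  (∀ (d : Q.ι → ℤ) (x : ∀ i, T.V (Q.sq i)), (∀ i, x i ∈ T.gr (Q.sq i) (d i)) →
    Φ.symm (1 ⊗ₜ PiTensorProduct.tprod ℤ x) ∈ T.gr S (∑ i, d i))

/-- `b` is a basis `𝟎, 𝟏` (indexed by `false, true`) for the square `S`: a free basis over `ℤ` with
`c(Γ₋) = {±𝟎}`, `c(Γ₊) = {±𝟏}`, in degrees `-1, 1`. -/
def IsSquareBasis (S : OccupiedSurface) (b : Module.Basis Bool ℤ (T.V S)) : Prop :=
  (∀ Γ : Sutures S, Γ.IsMinus → T.c S Γ = {b false, -b false}) ∧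
  (∀ Γ : Sutures S, Γ.IsPlus → T.c S Γ = {b true, -b true}) ∧
  b false ∈ T.gr S (-1) ∧ b true ∈ T.gr S 1

/-- The conditions for a twisted sutured quadrangulated field theory. -/
structure IsTwistedSQFT : Prop where
  grading : ∀ S, IsGrading (T.gr S)
  hom : ∀ S S' (m : DecoratedMorphism S S'), ∃ (f : T.V S →+ T.V S') (n : ℤ),
    IsGradedHom m.push (T.gr S) (T.gr S') f n ∧
      T.D S S' m = {g | EqUpToUnits (R' := Coeff S') (T.gr S) f g}
  decoratedIsotopy : ∀ S S' (m m' : DecoratedMorphism S S'), m.DecoratedIsotopic m' →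
    T.D S S' m = T.D S S' m'
  orbit : ∀ S (Γ : Sutures S), ∃ x : T.V S, T.c S Γ = {y | ∃ u : (Coeff S)ˣ, y = (u : Coeff S) • x}
  isotopy : ∀ S (Γ Γ' : Sutures S), Γ.Isotopic Γ' → T.c S Γ = T.c S Γ'
  functor_id : ∀ S (m : DecoratedMorphism S S), m.IsId → AddMonoidHom.id (T.V S) ∈ T.D S S m
  functor_comp : ∀ S S' S'' (m : DecoratedMorphism S S') (m' : DecoratedMorphism S' S'')
    (m'' : DecoratedMorphism S S''), m.IsComp m' m'' →
    ∀ f ∈ T.D S S' m, ∀ g ∈ T.D S' S'' m', g.comp f ∈ T.D S S'' m''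
  tensor : ∀ S (Q : Quadrangulation S), ∃ Φ, T.IsTensorDecomposition Q Φ
  respects : ∀ S S' (m : DecoratedMorphism S S') (Γ : Sutures S) (Γ' : Sutures S'),
    m.Sends Γ Γ' → ∀ f ∈ T.D S S' m, f '' T.c S Γ ⊆ T.c S' Γ'
  square : ∀ S, S.IsSquare → ∃ b, T.IsSquareBasis S b
  euler : ∀ S (Γ : Sutures S), T.c S Γ ⊆ T.gr S Γ.eulerClass

/-- `b` is the basis `|e₁ ⋯ eₙ⟩` of `V(Σ, V)` given by the quadrangulation `Q`, where each `eᵢ` is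
the element `𝟎` or `𝟏` of the `i`-th square. -/
def IsQuadrangulationBasis {S : OccupiedSurface} (Q : Quadrangulation S)
    (b : Module.Basis (Q.ι → Bool) (Coeff S) (T.V S)) : Prop :=
  ∃ Φ, T.IsTensorDecomposition Q Φ ∧
  ∃ β : ∀ i, Module.Basis Bool ℤ (T.V (Q.sq i)), (∀ i, T.IsSquareBasis (Q.sq i) (β i)) ∧
    ∀ ε, b ε = Φ.symm (1 ⊗ₜ PiTensorProduct.tprod ℤ (fun i => β i (ε i)))

end TwistedData

/-! ### Reduction mod 2 -/

/-- the canonical ring homomorphism `r_Σ : ℤ[H₁(Σ)] → ℤ/2`, sum of coefficients mod 2 -/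
def reduceCoeff (S : OccupiedSurface) : Coeff S →+* ZMod 2 :=
  (AddMonoidAlgebra.lift ℤ (ZMod 2) (H1 S) 1 : Coeff S →ₐ[ℤ] ZMod 2).toRingHom

/-- `ℤ/2` as an algebra over `ℤ[H₁(Σ)]` through `r_Σ` -/
@[reducible] def reduceAlgebra (S : OccupiedSurface) : Algebra (Coeff S) (ZMod 2) :=
  (reduceCoeff S).toAlgebra

attribute [local instance] reduceAlgebra

namespace TwistedData

variable (T : TwistedData)

/-- The reduced module `V_r(Σ, V)`: coefficients are changed along `r_Σ`, so that a basis over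
`ℤ[H₁(Σ)]` becomes a basis over `ℤ/2`. -/
abbrev Vr (S : OccupiedSurface) : Type _ := TensorProduct (Coeff S) (ZMod 2) (T.V S)

/-- the reduction map `R : V(Σ, V) → V_r(Σ, V)`, over the ring homomorphism `r_Σ` -/
def red (S : OccupiedSurface) : T.V S →ₛₗ[reduceCoeff S] T.Vr S where
  toFun x := (1 : ZMod 2) ⊗ₜ[Coeff S] x
  map_add' x y := TensorProduct.tmul_add _ x y
  map_smul' a x := by
    rw [← TensorProduct.smul_tmul, TensorProduct.smul_tmul', Algebra.smul_def, smul_eq_mul]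
    rfl

/-- the reduced grading -/
def grr (S : OccupiedSurface) (e : ℤ) : Submodule (ZMod 2) (T.Vr S) :=
  Submodule.span (ZMod 2) (T.red S '' T.gr S e)

/-- `Dr` consists of the reductions of the maps in `D`: the squares with the reduction maps
commute. -/
def IsReducedMap (Dr : ∀ S S', DecoratedMorphism S S' → (T.Vr S →ₗ[ZMod 2] T.Vr S')) : Prop :=
  ∀ S S' (m : DecoratedMorphism S S'), ∀ f ∈ T.D S S' m, ∀ x,
    Dr S S' m (T.red S x) = T.red S' (f x)

/-- `cr` consists of the reduced suture elements: the reduction of the orbit `c(Γ)` is the single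
element `cr(Γ)`. -/
def IsReducedSuture (cr : ∀ S, Sutures S → T.Vr S) : Prop :=
  ∀ S (Γ : Sutures S), T.red S '' T.c S Γ = {cr S Γ}

end TwistedData

end SQFT

end

noncomputable section

namespace SQFT

attribute [local instance] reduceAlgebra

/-! ### The quadrangulation of a square by itself -/

/-! Reduction works because the only unit of `ZMod 2` is `1`: the augmentation sends every unit of
the group ring to `1` (`reduceCoeff_unit`), so unit ambiguities vanish in the reduced modules. A
suture orbit collapses to one element. Two representatives of a decorated morphism differ by a unit
on each graded summand, so they agree after reduction, the summands spanning the module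
(`red_eq_of_eqUpToUnits`). A representative is semilinear over `φ_*`, and `φ_*` preserves the sum of
coefficients (`reduceCoeff_push`), so it descends to a `ZMod 2`-linear map. As the reduction map is
surjective and the classes of maps and elements are nonempty, everything is unique, and
functoriality and the action on sutures follow by lifting to representatives.

Bases survive any base change, which gives the statement on quadrangulation bases. The tensor axiom
needs more: the bases `𝟎, 𝟏` of squares are over `ℤ`, while reduction is over `ℤ[H₁]`. The two agree
if `H₁` of a square vanishes. This follows from the axioms without computing homology:
quadrangulating a square by itself gives a module that has rank 2 over `ℤ` and also a basis of two
elements over `ℤ[H₁]`, so `H₁` has one element (`subsingleton_H1`). The reduced tensor decomposition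
is then defined on bases and extended to all pure tensors by multilinearity
(`exists_reduced_tensor`). The grading survives because its projections are linear and descend
(`exists_projection`). -/

theorem eq_of_mem_edgesOf {X : Type} [TopologicalSpace X] {B V e e' : Set X}
    (he : e ∈ edgesOf B V) (he' : e' ∈ edgesOf B V) (h : (e ∩ e').Nonempty) : e = e' := by
  obtain ⟨x, -, rfl⟩ := he
  obtain ⟨y, -, rfl⟩ := he'
  obtain ⟨z, hz, hz'⟩ := h
  rw [connectedComponentIn_eq hz, connectedComponentIn_eq hz']

/-- the identity morphism -/
def Morphism.refl (S : OccupiedSurface) : Morphism S S where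
  map := ContinuousMap.id S
  embed := IsEmbedding.subtypeVal
  oriented e he e' he' x hx hx' := S.orient_compat e he e' he' x ⟨hx, hx'⟩
  edge_inj _ _ := injOn_id _
  edge_coincide e he e' he' h := by
    simp only [ContinuousMap.coe_id, image_id] at h ⊢
    exact eq_of_mem_edgesOf he he' h
  edge_boundary e he _ := by simpa using he
  vert_edge := by simpa using disjoint_sdiff_right
  pos_neg := by simpa using S.pos_neg_disjoint
  pos_boundary := by simp
  neg_boundary := by simp
  marks_glue := by
    rintro x hx y - rfl
    exact hx
  marks_boundary := by simp

theorem OccupiedSurface.IsSquare.connectedComponent_eq_univ {S : OccupiedSurface}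
    (hS : S.IsSquare) (x : S) : connectedComponent x = univ := by
  obtain ⟨h⟩ := hS.1
  have : PreconnectedSpace (Metric.closedBall (0 : ℂ) 1) :=
    Subtype.preconnectedSpace (convex_closedBall _ _).isPreconnected
  have : PreconnectedSpace S := h.symm.surjective.denseRange.preconnectedSpace h.symm.continuous
  exact PreconnectedSpace.connectedComponent_eq_univ x

/-- A square is connected, so its only component has four vertices rather than two. Hence a single
copy of the square covers all that a quadrangulation must cover. -/
theorem OccupiedSurface.IsSquare.vacuumPart_eq_empty {S : OccupiedSurface}
    (hS : S.IsSquare) : S.vacuumPart = ∅ := by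
  refine eq_empty_of_forall_notMem fun x hx => ?_
  have h := hx.2
  rw [hS.connectedComponent_eq_univ, univ_inter, hS.2] at h
  norm_num at h

/-- the quadrangulation of a square by itself -/
def Quadrangulation.ofSquare (S : OccupiedSurface) (hS : S.IsSquare) : Quadrangulation S where
  ι := Unit
  sq _ := S
  isSquare _ := hS
  incl _ := Morphism.refl S
  verts _ := by simp [Morphism.refl]
  disj i j h := (h rfl).elim
  edge_coincide _ _ := (Morphism.refl S).edge_coincide
  marks_glue _ _ := (Morphism.refl S).marks_glue
  cover := by
    rw [hS.vacuumPart_eq_empty, compl_empty]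
    exact eq_univ_of_forall fun x => mem_iUnion.2 ⟨(), x, rfl⟩

/-! ### Change of coefficients along the augmentation -/

theorem reduceCoeff_single (S : OccupiedSurface) (h : H1 S) (n : ℤ) :
    reduceCoeff S (AddMonoidAlgebra.single h n) = n := by
  simp [reduceCoeff]

/-- Pushing forward along `φ_*` moves group elements and leaves their coefficients alone, so the sum
of coefficients is unchanged. -/
theorem reduceCoeff_comp_push {S S' : OccupiedSurface} (φ : Morphism S S') :
    (reduceCoeff S').comp φ.push = reduceCoeff S := by
  refine AddMonoidAlgebra.ringHom_ext (fun r => ?_) fun h => ?_ <;>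
  simp [Morphism.push, reduceCoeff_single]

theorem reduceCoeff_push {S S' : OccupiedSurface} (φ : Morphism S S') (r : Coeff S) :
    reduceCoeff S' (φ.push r) = reduceCoeff S r :=
  RingHom.congr_fun (reduceCoeff_comp_push φ) r

theorem reduceCoeff_unit (S : OccupiedSurface) (u : (Coeff S)ˣ) :
    reduceCoeff S (u : Coeff S) = 1 := by
  have h : IsUnit (reduceCoeff S (u : Coeff S)) := u.isUnit.map _
  revert h
  generalize reduceCoeff S (u : Coeff S) = a
  revert a
  decide

/-- Surjectivity makes the image of a submodule under the semilinear reduction map a submodule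
again. -/
instance (S : OccupiedSurface) : RingHomSurjective (reduceCoeff S) :=
  ⟨fun a => ⟨AddMonoidAlgebra.single 0 (a.val : ℤ), by simp [reduceCoeff_single]⟩⟩

namespace TwistedData

variable (T : TwistedData)

theorem red_unit_smul (S : OccupiedSurface) (u : (Coeff S)ˣ) (x : T.V S) :
    T.red S ((u : Coeff S) • x) = T.red S x := by
  rw [map_smulₛₗ, reduceCoeff_unit, one_smul]

theorem red_surjective (S : OccupiedSurface) : Function.Surjective (T.red S) := by
  intro y
  induction y using TensorProduct.induction_on with
  | zero => exact ⟨0, map_zero _⟩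
  | add y z hy hz =>
    obtain ⟨a, rfl⟩ := hy
    obtain ⟨b, rfl⟩ := hz
    exact ⟨a + b, map_add _ _ _⟩
  | tmul a x =>
    obtain ⟨r, rfl⟩ := (reduceCoeff S).surjective a
    refine ⟨r • x, ?_⟩
    rw [map_smulₛₗ]
    change reduceCoeff S r • ((1 : ZMod 2) ⊗ₜ[Coeff S] x) = _
    rw [TensorProduct.smul_tmul', smul_eq_mul, mul_one]

/-- The image of a summand is already closed under scalars, so taking the span adds nothing; every
element of a reduced summand therefore lifts to a homogeneous element of the same degree. -/
theorem grr_eq_map (S : OccupiedSurface) (e : ℤ) :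
    T.grr S e = (T.gr S e).map (T.red S) := by
  rw [grr, ← Submodule.map_coe, Submodule.span_eq]

theorem mem_grr {S : OccupiedSurface} {e : ℤ} {y : T.Vr S} :
    y ∈ T.grr S e ↔ ∃ x ∈ T.gr S e, T.red S x = y := by
  rw [grr_eq_map, Submodule.mem_map]

theorem red_mem_grr {S : OccupiedSurface} {e : ℤ} {x : T.V S} (hx : x ∈ T.gr S e) :
    T.red S x ∈ T.grr S e :=
  T.mem_grr.2 ⟨x, hx, rfl⟩

/-- An additive map to a `ℤ/2`-module which is semilinear over the augmentation descends to the
reduced module. -/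
def descend {S : OccupiedSurface} {N : Type*} [AddCommGroup N] [Module (ZMod 2) N]
    (f : T.V S →+ N) (hf : ∀ r x, f (r • x) = reduceCoeff S r • f x) : T.Vr S →ₗ[ZMod 2] N :=
  -- With `N` viewed as a module over the group ring through the augmentation, `f` becomes linear,
  -- and extension of scalars yields `a ⊗ x ↦ a • f x`.
  letI : Module (Coeff S) N := Module.compHom N (reduceCoeff S)
  haveI : IsScalarTower (Coeff S) (ZMod 2) N := ⟨fun r a x => mul_smul (reduceCoeff S r) a x⟩
  let g : T.V S →ₗ[Coeff S] N := { toFun := f, map_add' := map_add f, map_smul' := hf }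
  TensorProduct.AlgebraTensorModule.lift ((LinearMap.toSpanSingleton (ZMod 2) _ g))

theorem descend_red {S : OccupiedSurface} {N : Type*} [AddCommGroup N] [Module (ZMod 2) N]
    (f : T.V S →+ N) (hf : ∀ r x, f (r • x) = reduceCoeff S r • f x) (x : T.V S) :
    T.descend f hf (T.red S x) = f x := by
  simp [descend, red]

/-- the reduction of a basis -/
def redBasis {S : OccupiedSurface} {κ : Type*} (b : Module.Basis κ (Coeff S) (T.V S)) :
    Module.Basis κ (ZMod 2) (T.Vr S) :=
  b.baseChange (ZMod 2)

theorem redBasis_apply {S : OccupiedSurface} {κ : Type*}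
    (b : Module.Basis κ (Coeff S) (T.V S)) (k : κ) : T.redBasis b k = T.red S (b k) :=
  Module.Basis.baseChange_apply _ _ _

/-! ### Bases from quadrangulations -/

/-- the basis of `V(Σ, V)` given by a tensor decomposition and bases for the squares -/
def quadBasis {S : OccupiedSurface} {Q : Quadrangulation S}
    (Φ : T.V S ≃ₗ[Coeff S] Coeff S ⊗[ℤ] PiTensorProduct ℤ (fun i => T.V (Q.sq i)))
    (β : ∀ i, Module.Basis Bool ℤ (T.V (Q.sq i))) :
    Module.Basis (Q.ι → Bool) (Coeff S) (T.V S) :=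
  ((Basis.piTensorProduct β).baseChange (Coeff S)).map Φ.symm

theorem quadBasis_apply {S : OccupiedSurface} {Q : Quadrangulation S}
    (Φ : T.V S ≃ₗ[Coeff S] Coeff S ⊗[ℤ] PiTensorProduct ℤ (fun i => T.V (Q.sq i)))
    (β : ∀ i, Module.Basis Bool ℤ (T.V (Q.sq i))) (ε : Q.ι → Bool) :
    T.quadBasis Φ β ε = Φ.symm (1 ⊗ₜ PiTensorProduct.tprod ℤ (fun i => β i (ε i))) := by
  simp [quadBasis]

/-- The group elements form a `ℤ`-basis of `ℤ[H₁]`. Multiplied with the two-element basis from the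
trivial quadrangulation, they form a `ℤ`-basis of a module of `ℤ`-rank 2. Comparing cardinalities
gives `|H₁| · 2 = 2`. -/
theorem IsTwistedSQFT.subsingleton_H1 {T : TwistedData} (hT : T.IsTwistedSQFT)
    {S : OccupiedSurface} (hS : S.IsSquare) : Subsingleton (H1 S) := by
  obtain ⟨β, -⟩ := hT.square S hS
  obtain ⟨Φ, -⟩ := hT.tensor S (Quadrangulation.ofSquare S hS)
  let b : Module.Basis (Unit → Bool) (Coeff S) (T.V S) := T.quadBasis Φ fun _ => β
  have e := ((AddMonoidAlgebra.basis (H1 S) ℤ).smulTower b).indexEquiv β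
  have : Finite (H1 S × (Unit → Bool)) := Finite.of_equiv _ e.symm
  have hf : Finite (H1 S) := Finite.of_surjective (Prod.fst : H1 S × (Unit → Bool) → H1 S)
    Prod.fst_surjective
  have h := Nat.card_congr e
  rw [Nat.card_prod] at h
  simp at h
  exact (Nat.card_eq_one_iff_unique.1 h).1

variable {T}

theorem IsReducedMap.mem_grr {Dr : ∀ S S', DecoratedMorphism S S' → (T.Vr S →ₗ[ZMod 2] T.Vr S')}
    (hDr : T.IsReducedMap Dr) {S S' : OccupiedSurface} (m : DecoratedMorphism S S') (n : ℤ)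
    (h : ∃ f ∈ T.D S S' m, IsGradedHom m.push (T.gr S) (T.gr S') f n) (e : ℤ) (y : T.Vr S)
    (hy : y ∈ T.grr S e) : Dr S S' m y ∈ T.grr S' (e + n) := by
  obtain ⟨f, hf, hn⟩ := h
  obtain ⟨x, hx, rfl⟩ := TwistedData.mem_grr T |>.1 hy
  rw [hDr S S' m f hf]
  exact T.red_mem_grr (hn.2 e x hx)

theorem IsReducedSuture.red_eq {cr : ∀ S, Sutures S → T.Vr S}
    (h : T.IsReducedSuture cr) {S : OccupiedSurface} {Γ : Sutures S} {x : T.V S}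
    (hx : x ∈ T.c S Γ) : T.red S x = cr S Γ := by
  have h1 : T.red S x ∈ T.red S '' T.c S Γ := ⟨x, hx, rfl⟩
  rwa [h S Γ] at h1

/-! ### Coefficients and bases on squares -/

namespace IsTwistedSQFT

variable (hT : T.IsTwistedSQFT)

include hT

theorem intCast_bijective {S : OccupiedSurface} (hS : S.IsSquare) :
    Function.Bijective (Int.castRingHom (Coeff S)) := by
  have := hT.subsingleton_H1 hS
  have hc : ∀ n : ℤ, Int.castRingHom (Coeff S) n = AddMonoidAlgebra.single 0 n := fun n => by
    simp [AddMonoidAlgebra.intCast_def]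
  refine ⟨fun m n h => ?_, fun r => ?_⟩
  · rw [hc, hc] at h
    simpa using congrArg (fun r : Coeff S => r.coeff 0) h
  · refine ⟨r.coeff 0, ?_⟩
    rw [hc]
    ext h
    rw [Subsingleton.elim h 0]
    simp

/-- For a square, a basis over `ℤ` is a basis over the coefficient ring. -/
theorem exists_basis_coeff {S : OccupiedSurface} (hS : S.IsSquare) {κ : Type*}
    (β : Module.Basis κ ℤ (T.V S)) :
    ∃ b : Module.Basis κ (Coeff S) (T.V S), ∀ k, b k = β k :=
  ⟨β.mapCoeffs (RingEquiv.ofBijective _ (hT.intCast_bijective hS)) fun n x => by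
    simp [Int.cast_smul_eq_zsmul], fun k => by simp⟩

/-- The square axiom supplies a basis over `ℤ`, whereas reduction changes coefficients from `ℤ[H₁]`.
On a square these rings coincide, so base change applies. -/
theorem exists_redBasis_square {S : OccupiedSurface} (hS : S.IsSquare) {κ : Type*}
    (β : Module.Basis κ ℤ (T.V S)) :
    ∃ b : Module.Basis κ (ZMod 2) (T.Vr S), ∀ k, b k = T.red S (β k) := by
  obtain ⟨b, hb⟩ := hT.exists_basis_coeff hS β
  exact ⟨T.redBasis b, fun k => by rw [redBasis_apply, hb]⟩

theorem exists_quadrangulationBasis {S : OccupiedSurface} (Q : Quadrangulation S) :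
    ∃ b, T.IsQuadrangulationBasis Q b := by
  obtain ⟨Φ, hΦ⟩ := hT.tensor S Q
  choose β hβ using fun i => hT.square (Q.sq i) (Q.isSquare i)
  exact ⟨T.quadBasis Φ β, Φ, hΦ, β, hβ, T.quadBasis_apply Φ β⟩

/-! ### Reduced maps and reduced suture elements -/

theorem iSup_gr (S : OccupiedSurface) : ⨆ e, T.gr S e = ⊤ :=
  (hT.grading S).1.submodule_iSup_eq_top

/-- The unit may vary with the degree, but each one reduces to `1`. The maps thus agree on
homogeneous elements after reduction, and these generate the module. -/
theorem red_eq_of_eqUpToUnits {S S' : OccupiedSurface} {f g : T.V S →+ T.V S'}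
    (h : EqUpToUnits (R' := Coeff S') (T.gr S) f g) (x : T.V S) :
    T.red S' (g x) = T.red S' (f x) := by
  obtain ⟨z, hz⟩ := h
  have hx : x ∈ ⨆ e, T.gr S e := by simp [hT.iSup_gr]
  induction hx using Submodule.iSup_induction' with
  | mem e x hx => rw [hz e x hx, red_unit_smul]
  | zero => simp
  | add x y _ _ hx hy => simp only [map_add, hx, hy]

theorem exists_reducedMap {S S' : OccupiedSurface} (m : DecoratedMorphism S S') :
    ∃ d : T.Vr S →ₗ[ZMod 2] T.Vr S', ∀ f ∈ T.D S S' m, ∀ x, d (T.red S x) = T.red S' (f x) := by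
  obtain ⟨f, n, hf, hD⟩ := hT.hom S S' m
  refine ⟨T.descend ((T.red S').toAddMonoidHom.comp f) fun r x => ?_, fun g hg x => ?_⟩
  · change T.red S' (f (r • x)) = reduceCoeff S r • T.red S' (f x)
    rw [hf.1, map_smulₛₗ, reduceCoeff_push]
  · rw [hD] at hg
    rw [hT.red_eq_of_eqUpToUnits hg, descend_red]
    rfl

theorem D_nonempty {S S' : OccupiedSurface} (m : DecoratedMorphism S S') :
    (T.D S S' m).Nonempty := by
  obtain ⟨f, n, -, hD⟩ := hT.hom S S' m
  exact ⟨f, hD ▸ ⟨1, fun e x _ => by simp⟩⟩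

/-- Uniqueness uses that each class has a representative, which fixes the value on every reduced
element, and that reduction is surjective. -/
theorem existsUnique_reducedMap : ∃! Dr, T.IsReducedMap Dr := by
  choose Dr hDr using fun S S' (m : DecoratedMorphism S S') => hT.exists_reducedMap m
  refine ⟨Dr, hDr, fun Dr' h => ?_⟩
  funext S S' m
  obtain ⟨f, hf⟩ := hT.D_nonempty m
  refine LinearMap.ext fun y => ?_
  obtain ⟨x, rfl⟩ := T.red_surjective S y
  rw [h S S' m f hf, hDr S S' m f hf]

theorem c_nonempty {S : OccupiedSurface} (Γ : Sutures S) : (T.c S Γ).Nonempty := by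
  obtain ⟨x, hx⟩ := hT.orbit S Γ
  exact ⟨x, hx ▸ ⟨1, by simp⟩⟩

theorem existsUnique_reducedSuture : ∃! cr, T.IsReducedSuture cr := by
  choose x hx using fun S (Γ : Sutures S) => hT.orbit S Γ
  refine ⟨fun S Γ => T.red S (x S Γ), fun S Γ => ?_, fun cr h => ?_⟩
  · refine eq_singleton_iff_nonempty_unique_mem.2 ⟨(hT.c_nonempty Γ).image _, ?_⟩
    rintro _ ⟨y, hy, rfl⟩
    rw [hx] at hy
    obtain ⟨u, rfl⟩ := hy
    exact T.red_unit_smul S u _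
  · funext S Γ
    have h1 : T.red S (x S Γ) ∈ T.red S '' T.c S Γ := ⟨_, hx S Γ ▸ ⟨1, by simp⟩, rfl⟩
    rw [h S Γ] at h1
    exact (mem_singleton_iff.1 h1).symm

/-! ### The reduced grading -/

/-- The projection to the summand of degree `e` is linear over the group ring, so it descends to the
reduced module. -/
theorem exists_projection (S : OccupiedSurface) (e : ℤ) :
    ∃ p : T.Vr S →ₗ[ZMod 2] T.Vr S, (∀ y ∈ T.grr S e, p y = y) ∧
      ∀ e' ≠ e, ∀ y ∈ T.grr S e', p y = 0 := by
  let := (hT.grading S).1.chooseDecomposition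
  let q : T.V S →+ T.V S :=
    { toFun := fun x => (DirectSum.decompose (T.gr S) x e : T.V S)
      map_zero' := by simp
      map_add' := fun x y => by simp }
  have hq : ∀ (r : Coeff S) x, q (r • x) = r • q x := fun r x => by
    simp only [q, AddMonoidHom.coe_mk, ZeroHom.coe_mk, DirectSum.decompose_smul]
    rfl
  refine ⟨T.descend ((T.red S).toAddMonoidHom.comp q) fun r x => ?_, fun y hy => ?_,
    fun e' he y hy => ?_⟩
  · change T.red S (q (r • x)) = reduceCoeff S r • T.red S (q x)
    rw [hq, map_smulₛₗ]
  · obtain ⟨x, hx, rfl⟩ := T.mem_grr.1 hy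
    rw [descend_red]
    exact congrArg (T.red S) (DirectSum.decompose_of_mem_same _ hx)
  · obtain ⟨x, hx, rfl⟩ := T.mem_grr.1 hy
    rw [descend_red]
    exact (congrArg (T.red S) (DirectSum.decompose_of_mem_ne _ hx he)).trans (map_zero _)

theorem isGrading_grr (S : OccupiedSurface) : IsGrading (T.grr S) := by
  refine ⟨DirectSum.isInternal_submodule_of_iSupIndep_of_iSup_eq_top ?_ ?_,
    (hT.grading S).2.subset fun e he h => he ?_⟩
  -- Independence can fail for images under a surjection. Here the descended projection fixes the
  -- summand of degree `e` and kills all others, so the intersection is zero.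
  · intro e
    obtain ⟨p, hp, hp'⟩ := hT.exists_projection S e
    rw [Submodule.disjoint_def]
    intro y hy hy'
    have hle : ⨆ (j) (_ : j ≠ e), T.grr S j ≤ LinearMap.ker p :=
      iSup₂_le fun j hj y hy => hp' j hj y hy
    rw [← hp y hy]
    exact hle hy'
  · rw [funext (T.grr_eq_map S), ← Submodule.map_iSup, hT.iSup_gr, Submodule.map_top, LinearMap.range_eq_top]
    exact T.red_surjective S
  · rw [grr_eq_map, h, Submodule.map_bot]

/-! ### Tensor decompositions of the reduced modules -/

/-- `Φr` is defined by matching reduced basis elements, but it has to be known on all pure tensors,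
since suture elements and homogeneous elements need not be basis elements. Both sides are
`ℤ`-multilinear in `x`, so agreement on bases suffices. -/
theorem exists_reduced_tensor {S : OccupiedSurface} (Q : Quadrangulation S)
    (Φ : T.V S ≃ₗ[Coeff S] Coeff S ⊗[ℤ] PiTensorProduct ℤ (fun i => T.V (Q.sq i))) :
    ∃ Φr : T.Vr S ≃ₗ[ZMod 2] PiTensorProduct (ZMod 2) (fun i => T.Vr (Q.sq i)),
      ∀ x : ∀ i, T.V (Q.sq i), Φr (T.red S (Φ.symm (1 ⊗ₜ PiTensorProduct.tprod ℤ x))) =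
        PiTensorProduct.tprod (ZMod 2) fun i => T.red (Q.sq i) (x i) := by
  choose β _ using fun i => hT.square (Q.sq i) (Q.isSquare i)
  choose βr hβr using fun i => hT.exists_redBasis_square (Q.isSquare i) (β i)
  let Φr := (T.redBasis (T.quadBasis Φ β)).equiv (Basis.piTensorProduct βr) (Equiv.refl _)
  refine ⟨Φr, fun x => ?_⟩
  let h : PiTensorProduct ℤ (fun i => T.V (Q.sq i)) →+
      PiTensorProduct (ZMod 2) (fun i => T.Vr (Q.sq i)) :=
    Φr.toLinearMap.toAddMonoidHom.comp ((T.red S).toAddMonoidHom.comp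
      (Φ.symm.toLinearMap.toAddMonoidHom.comp
        (TensorProduct.mk ℤ (Coeff S) _ 1).toAddMonoidHom))
  -- An additive map commutes with integer multiples for any `ℤ`-module structures; the one named
  -- here is the structure carried by the target tensor product.
  let l : PiTensorProduct ℤ (fun i => T.V (Q.sq i)) →ₗ[ℤ]
      PiTensorProduct (ZMod 2) (fun i => T.Vr (Q.sq i)) :=
    { toFun := h
      map_add' := map_add h
      map_smul' := @map_intCast_smul _ _ _ _ _ _ _ h ℤ ℤ _ _ _ PiTensorProduct.module' }
  let f : MultilinearMap ℤ (fun i => T.V (Q.sq i))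
      (PiTensorProduct (ZMod 2) (fun i => T.Vr (Q.sq i))) :=
    l.compMultilinearMap (PiTensorProduct.tprod ℤ)
  let g : MultilinearMap ℤ (fun i => T.V (Q.sq i))
      (PiTensorProduct (ZMod 2) (fun i => T.Vr (Q.sq i))) :=
    ((PiTensorProduct.tprod (ZMod 2)).restrictScalars ℤ).compLinearMap
      fun i => (T.red (Q.sq i)).toAddMonoidHom.toIntLinearMap
  have hfg : f = g := by
    refine Module.Basis.ext_multilinear β fun ε => ?_
    change Φr (T.red S (Φ.symm (1 ⊗ₜ PiTensorProduct.tprod ℤ fun i => β i (ε i)))) =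
      PiTensorProduct.tprod (ZMod 2) fun i => T.red (Q.sq i) (β i (ε i))
    rw [← quadBasis_apply, ← redBasis_apply, Module.Basis.equiv_apply, Basis.piTensorProduct_apply]
    simp [hβr]
  exact DFunLike.congr_fun hfg x

theorem reduced_tensor {cr : ∀ S, Sutures S → T.Vr S} (hcr : T.IsReducedSuture cr)
    {S : OccupiedSurface} (Q : Quadrangulation S) :
    ∃ Φ : T.Vr S ≃ₗ[ZMod 2] PiTensorProduct (ZMod 2) (fun i => T.Vr (Q.sq i)),
      (∀ Γ Γs, Q.IsBasic Γ → Q.Restricts Γ Γs →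
        Φ (cr S Γ) = PiTensorProduct.tprod (ZMod 2) (fun i => cr (Q.sq i) (Γs i))) ∧
      (∀ (d : Q.ι → ℤ) (x : ∀ i, T.Vr (Q.sq i)), (∀ i, x i ∈ T.grr (Q.sq i) (d i)) →
        Φ.symm (PiTensorProduct.tprod (ZMod 2) x) ∈ T.grr S (∑ i, d i)) := by
  obtain ⟨Φ, hc, hd⟩ := hT.tensor S Q
  obtain ⟨Φr, hΦr⟩ := hT.exists_reduced_tensor Q Φ
  refine ⟨Φr, fun Γ Γs hΓ hΓs => ?_, fun d x hx => ?_⟩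
  · choose x hx using fun i => hT.c_nonempty (Γs i)
    -- One element of the orbit determines `cr S Γ`, so the unit `1` and arbitrary representatives
    -- on the squares suffice.
    have hm : (1 : Coeff S) ⊗ₜ[ℤ] PiTensorProduct.tprod ℤ x ∈ Φ '' T.c S Γ := by
      rw [hc Γ Γs hΓ hΓs]
      exact ⟨1, x, hx, by simp⟩
    obtain ⟨z, hz, hzx⟩ := hm
    rw [← hcr.red_eq hz, ← Φ.symm_apply_apply z, hzx, hΦr]
    exact congrArg _ (funext fun i => hcr.red_eq (hx i))
  -- Homogeneous reduced factors lift to homogeneous factors of the same degrees, where the degree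
  -- formula for `Φ` applies.
  · choose y hy hyx using fun i => T.mem_grr.1 (hx i)
    obtain rfl : (fun i => T.red (Q.sq i) (y i)) = x := funext hyx
    rw [← hΦr, LinearEquiv.symm_apply_apply]
    exact T.red_mem_grr (hd d y hy)

/-! ### The axioms for the reduced theory -/

theorem isSQFT {Dr : ∀ S S', DecoratedMorphism S S' → (T.Vr S →ₗ[ZMod 2] T.Vr S')}
    {cr : ∀ S, Sutures S → T.Vr S} (hDr : T.IsReducedMap Dr) (hcr : T.IsReducedSuture cr) :
    IsSQFT T.Vr T.grr Dr cr where
  functor_id S m hm := by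
    refine LinearMap.ext fun y => ?_
    obtain ⟨x, rfl⟩ := T.red_surjective S y
    exact hDr S S m _ (hT.functor_id S m hm) x
  functor_comp S S' S'' m m' m'' h := by
    obtain ⟨f, hf⟩ := hT.D_nonempty m
    obtain ⟨g, hg⟩ := hT.D_nonempty m'
    refine LinearMap.ext fun y => ?_
    obtain ⟨x, rfl⟩ := T.red_surjective S y
    rw [LinearMap.comp_apply, hDr S S' m f hf, hDr S' S'' m' g hg,
      hDr S S'' m'' _ (hT.functor_comp S S' S'' m m' m'' h f hf g hg)]
    rfl
  isotopy S Γ Γ' h := by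
    obtain ⟨x, hx⟩ := hT.c_nonempty Γ
    rw [← hcr.red_eq hx, hcr.red_eq (hT.isotopy S Γ Γ' h ▸ hx)]
  grading := hT.isGrading_grr
  tensor S Q := hT.reduced_tensor hcr Q
  respects S S' m Γ Γ' h := by
    obtain ⟨f, hf⟩ := hT.D_nonempty m
    obtain ⟨x, hx⟩ := hT.c_nonempty Γ
    rw [← hcr.red_eq hx, hDr S S' m f hf,
      hcr.red_eq (hT.respects S S' m Γ Γ' h f hf (mem_image_of_mem f hx))]
  square S hS := by
    obtain ⟨β, hm, hp, h0, h1⟩ := hT.square S hS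
    obtain ⟨b, hb⟩ := hT.exists_redBasis_square hS β
    refine ⟨b, fun Γ hΓ => ?_, fun Γ hΓ => ?_, ?_, ?_⟩
    · rw [hb, hcr.red_eq (Γ := Γ)]
      simp [hm Γ hΓ]
    · rw [hb, hcr.red_eq (Γ := Γ)]
      simp [hp Γ hΓ]
    · exact hb _ ▸ T.red_mem_grr h0
    · exact hb _ ▸ T.red_mem_grr h1
  euler S Γ := by
    obtain ⟨x, hx⟩ := hT.c_nonempty Γ
    exact hcr.red_eq hx ▸ T.red_mem_grr (hT.euler S Γ hx)

end IsTwistedSQFT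
end TwistedData
end SQFT

end

theorem mainTheorem9 (T : SQFT.TwistedData) (hT : T.IsTwistedSQFT) :
    (∀ S (Q : SQFT.Quadrangulation S),
      (∃ b, T.IsQuadrangulationBasis Q b) ∧
      ∀ b, T.IsQuadrangulationBasis Q b →
        ∃ b' : Module.Basis (Q.ι → Bool) (ZMod 2) (T.Vr S), ∀ ε, b' ε = T.red S (b ε)) ∧
    (∃! Dr, T.IsReducedMap Dr) ∧
    (∃! cr, T.IsReducedSuture cr) ∧
    ∀ Dr cr, T.IsReducedMap Dr → T.IsReducedSuture cr →
      (∀ S S' (m : SQFT.DecoratedMorphism S S') (n : ℤ),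
        (∃ f ∈ T.D S S' m, SQFT.IsGradedHom m.push (T.gr S) (T.gr S') f n) →
        ∀ e, ∀ x ∈ T.grr S e, Dr S S' m x ∈ T.grr S' (e + n)) ∧
      SQFT.IsSQFT T.Vr T.grr Dr cr :=
  ⟨fun _ Q => ⟨hT.exists_quadrangulationBasis Q,
      fun b _ => ⟨T.redBasis b, T.redBasis_apply b⟩⟩,
    hT.existsUnique_reducedMap, hT.existsUnique_reducedSuture,
    fun _ _ hDr hcr => ⟨fun _ _ m n h e x hx => hDr.mem_grr m n h e x hx,
      hT.isSQFT hDr hcr⟩⟩
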